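/- Let $K$ be a number field with ring of integers $\mathcal O_K$, with $r_1$ real embeddings and $2r_2$ complex embeddings, and put $r=r_1+r_2-1$. Let $d_K$, $h_K$, $R_K$, $\mu_K$ denote the discriminant, the class number, the regulator and the group of roots of unity of $K$, and let $\alpha_K=\lim_{s\to1^+}(s-1)\zeta_K(s)$ be the residue at $s=1$ of the Dedekind zeta function of $K$. Let $\mathfrak q$ be a nonzero ideal of $\mathcal O_K$, put $\varphi(\mathfrak q)=\mathfrak N(\mathfrak q)\prod_{\mathfrak p\mid\mathfrak q}\bigl(1-\tfrac1{\mathfrak N(\mathfrak p)}\bigr)$, the product being over the prime ideals dividing $\mathfrak q$, and let $\mathfrak q_1=\mathfrak q\mathfrak q_\infty$ be the modulus in which $\mathfrak q$ is completed by all Archimedean places. For $\alpha\in K^\times$ write $\alpha\equiv1\bmod^*\mathfrak q_1$ if $\alpha$ is prime to $\mathfrak q$, $v_{\mathfrak p}(\alpha-1)\ge v_{\mathfrak p}(\mathfrak q)$ for all primes $\mathfrak p\mid\mathfrak q$, and $\sigma(\alpha)>0$ for all embeddings $\sigma:K\to\mathbb R$. Let - $h_{K,\mathfrak q}$ be the cardinality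 of the narrow ray class group $I(\mathfrak q)/P_{\mathfrak q}$, where $I(\mathfrak q)$ is the group of fractional ideals of $K$ coprime to $\mathfrak q$ and $P_{\mathfrak q}$ is the subgroup of the principal ideals $(\alpha)$ with $\alpha\equiv1\bmod^*\mathfrak q_1$; - $U_{\mathfrak q_1}$ be the group of the units $u\in\mathcal O_K^*$ with $u\equiv1\bmod^*\mathfrak q_1$, and $\mu_{\mathfrak q_1}=|U_{\mathfrak q_1}\cap\mu_K|$; - $R_{K,\mathfrak q_1}=\bigl|\det\bigl(e_i\log|\sigma_i(\eta_j)|\bigr)_{1\le i,j\le r}\bigr|$, where $\eta_1,\dots,\eta_r\in U_{\mathfrak q_1}$ are multiplicatively independent units that generate $U_{\mathfrak q_1}$ modulo roots of unity, $\sigma_1,\dots,\sigma_r$ are embeddings of $K$ into $\mathbb C$ no two of which are equal or complex conjugate, and $e_i=1$ or $2$ according to whether $\sigma_i$ is real or complex. (This depends neither on the units nor on the embeddings chosen, and it is $1$ if $r=0$.) Then $$\frac{(2\pi)^{r_2}R_{K,\mathfrak q_1}}{\mu_{\mathfrak q_1}\sqrt{|d_K|}}=\frac{\alpha_K\,\varphi(\mathfrak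 q)}{h_{K,\mathfrak q}} \qquad\text{and}\qquad \frac{R_{K,\mathfrak q_1}}{R_K}=\frac{\mu_{\mathfrak q_1}}{|\mu_K|}\cdot\frac{2^{r_1}\varphi(\mathfrak q)h_K}{h_{K,\mathfrak q}}.$$ -/

import Mathlib

open NumberField IsDedekindDomain Filter Topology
open scoped nonZeroDivisors Real

namespace RayClass

noncomputable section

variable (K : Type*) [Field K] [NumberField K]

/-- The residue at `s = 1` of the Dedekind zeta function of `K`, that is the limit of
`(s - 1) ζ_K(s)` as `s` tends to `1` through real numbers `s > 1`. -/
def zetaResidue : ℂ :=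
  limUnder (𝓝[>] (1 : ℝ)) (fun s : ℝ ↦ ((s : ℂ) - 1) * dedekindZeta K (s : ℂ))

/-- The limit that defines the residue exists. -/
theorem tendsto_zetaResidue :
    Tendsto (fun s : ℝ ↦ ((s : ℂ) - 1) * dedekindZeta K (s : ℂ)) (𝓝[>] 1)
      (𝓝 (zetaResidue K)) :=
  tendsto_nhds_limUnder ⟨_, tendsto_sub_one_mul_dedekindZeta_nhdsGT K⟩

variable {K}

open Classical in
/-- The Euler function of an ideal: `φ(𝔮) = N(𝔮) ∏_{𝔭 ∣ 𝔮} (1 - 1 / N(𝔭))`, the product being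
over the distinct prime ideals that divide `𝔮`. -/
def idealPhi (q : Ideal (𝓞 K)) : ℝ :=
  (Ideal.absNorm q : ℝ) *
    ∏ p ∈ (UniqueFactorizationMonoid.normalizedFactors q).toFinset,
      (1 - 1 / (Ideal.absNorm p : ℝ))

/-- `v_𝔭(I)`, the exponent of the prime `𝔭 = v` in the nonzero fractional ideal `I`. -/
abbrev idealOrd (v : HeightOneSpectrum (𝓞 K)) (I : FractionalIdeal (𝓞 K)⁰ K) : ℤ :=
  FractionalIdeal.count K v I

/-- The group `I(𝔮)` of fractional ideals of `K` that are coprime to `𝔮`. -/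
def coprimeIdeals (q : Ideal (𝓞 K)) : Subgroup (FractionalIdeal (𝓞 K)⁰ K)ˣ where
  carrier := {I | ∀ v : HeightOneSpectrum (𝓞 K), v.asIdeal ∣ q → idealOrd v I = 0}
  one_mem' := fun v _ ↦ by simpa using FractionalIdeal.count_one K v
  mul_mem' := fun {I J} hI hJ v hv ↦ by
    rw [idealOrd, Units.val_mul, FractionalIdeal.count_mul K v I.ne_zero J.ne_zero]
    simp [hI v hv, hJ v hv]
  inv_mem' := fun {I} hI v hv ↦ by
    rw [idealOrd, Units.val_inv_eq_inv_val, FractionalIdeal.count_inv]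
    simp [hI v hv]

/-- `α ≡ 1 mod* 𝔮_1`: the element `α` is prime to `𝔮`, `v_𝔭(α - 1) ≥ v_𝔭(𝔮)` for every prime
`𝔭 ∣ 𝔮`, and `σ(α) > 0` for every real embedding `σ`. The `𝔭`-adic valuation is written
multiplicatively here, so that the inequality is reversed. -/
def IsOneModStar (q : Ideal (𝓞 K)) (α : K) : Prop :=
  (∀ v : HeightOneSpectrum (𝓞 K), v.asIdeal ∣ q → v.valuation K α = 1 ∧
    v.valuation K (α - 1) ≤ WithZero.exp (-idealOrd v (q : FractionalIdeal (𝓞 K)⁰ K))) ∧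
  ∀ σ : K →+* ℝ, 0 < σ α

/-- The group of the elements `α` of `Kˣ` with `α ≡ 1 mod* 𝔮_1`. -/
def oneModStar (q : Ideal (𝓞 K)) : Subgroup Kˣ where
  carrier := {α | IsOneModStar q (α : K)}
  one_mem' := ⟨fun v _ ↦ by simp, fun σ ↦ by simp⟩
  mul_mem' := fun {a b} ha hb ↦ by
    refine ⟨fun v hv ↦ ⟨?_, ?_⟩, fun σ ↦ ?_⟩
    · simp [(ha.1 v hv).1, (hb.1 v hv).1]
    · have e : ((a * b : Kˣ) : K) - 1 = ((a : K) - 1) * b + ((b : K) - 1) := by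
        push_cast; ring
      rw [e]
      refine ((v.valuation K).map_add _ _).trans (max_le ?_ (hb.1 v hv).2)
      rw [map_mul, (hb.1 v hv).1, mul_one]
      exact (ha.1 v hv).2
    · simpa using mul_pos (ha.2 σ) (hb.2 σ)
  inv_mem' := fun {a} ha ↦ by
    refine ⟨fun v hv ↦ ⟨?_, ?_⟩, fun σ ↦ ?_⟩
    · simp [(ha.1 v hv).1]
    · have e : ((a⁻¹ : Kˣ) : K) - 1 = -((a : K) - 1) * (a : K)⁻¹ := by
        have := a.ne_zero
        rw [Units.val_inv_eq_inv_val]; field_simp; ring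
      rw [e, map_mul, Valuation.map_neg, map_inv₀, (ha.1 v hv).1, inv_one, mul_one]
      exact (ha.1 v hv).2
    · simpa using ha.2 σ

/-- The group `P_𝔮` of the principal fractional ideals `(α)` with `α ≡ 1 mod* 𝔮_1`. -/
def principalRay (q : Ideal (𝓞 K)) : Subgroup (FractionalIdeal (𝓞 K)⁰ K)ˣ :=
  (oneModStar q).map (toPrincipalIdeal (𝓞 K) K)

/-- The narrow ray class group `H_𝔮(K) = I(𝔮) / P_𝔮`. -/
abbrev NarrowRayClassGroup (q : Ideal (𝓞 K)) : Type _ :=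
  coprimeIdeals q ⧸ (principalRay q).subgroupOf (coprimeIdeals q)

/-- `h_{K,𝔮}`, the cardinality of the narrow ray class group. -/
def narrowRayClassNumber (q : Ideal (𝓞 K)) : ℕ := Nat.card (NarrowRayClassGroup q)

/-- `U_{𝔮_1}`, the group of the units of `𝓞 K` that are `1 mod* 𝔮_1`. -/
def rayUnits (q : Ideal (𝓞 K)) : Subgroup (𝓞 K)ˣ :=
  (oneModStar q).comap (Units.map (algebraMap (𝓞 K) K).toMonoidHom)

/-- `μ_{𝔮_1}`, the number of roots of unity in `U_{𝔮_1}`. -/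
def rayTorsionOrder (q : Ideal (𝓞 K)) : ℕ :=
  Nat.card (rayUnits q ⊓ Units.torsion K : Subgroup (𝓞 K)ˣ)

/-- `η_1, …, η_r`, where `r = r_1 + r_2 - 1`, are multiplicatively independent elements of
`U_{𝔮_1}` that generate `U_{𝔮_1}` modulo the roots of unity. -/
structure IsRayFundSystem (q : Ideal (𝓞 K)) (η : Fin (Units.rank K) → (𝓞 K)ˣ) : Prop where
  mem : ∀ j, η j ∈ rayUnits q
  indep : ∀ n : Fin (Units.rank K) → ℤ, ∏ j, η j ^ n j = 1 → n = 0
  generate : rayUnits q ≤ Subgroup.closure (Set.range η) ⊔ Units.torsion K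

/-- `|det (e_i log |σ_i(η_j)|)_{i,j}|`, where `σ_1, …, σ_r` are all the infinite places but one,
the place `w₀`, and `e_i` is `1` or `2` as `σ_i` is real or complex. -/
def unitDet (w₀ : InfinitePlace K) (σ : Fin (Units.rank K) ≃ {w : InfinitePlace K // w ≠ w₀})
    (η : Fin (Units.rank K) → (𝓞 K)ˣ) : ℝ :=
  |(Matrix.of fun i j : Fin (Units.rank K) ↦
    ((σ i).1.mult : ℝ) * Real.log ((σ i).1 (η j : K))).det|

open Classical in
/-- The `𝔮_1`-regulator `R_{K,𝔮_1}` for `𝔮 ≠ 0`: the value of `unitDet` for some choice of the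
places and of the generating units. By `exists_isRayFundSystem` there are such units, and by
`rayRegulator_eq` the choices do not matter. -/
def rayRegulator (q : Ideal (𝓞 K)) : ℝ :=
  if h : ∃ η, IsRayFundSystem q η then
    unitDet Units.dirichletUnitTheorem.w₀ (Units.equivFinRank K) h.choose
  else 0

theorem unitDet_eq_regOfFamily (w₀ : InfinitePlace K)
    (σ : Fin (Units.rank K) ≃ {w : InfinitePlace K // w ≠ w₀})
    (η : Fin (Units.rank K) → (𝓞 K)ˣ) : unitDet w₀ σ η = Units.regOfFamily η := by
  classical
  rw [Units.regOfFamily_eq_det η w₀ σ.symm, unitDet, ← Matrix.det_transpose,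
    ← Matrix.det_reindex_self σ]
  congr 2
  ext i j
  simp

theorem IsRayFundSystem.sup_eq {q : Ideal (𝓞 K)} {η : Fin (Units.rank K) → (𝓞 K)ˣ}
    (h : IsRayFundSystem q η) :
    Subgroup.closure (Set.range η) ⊔ Units.torsion K = rayUnits q ⊔ Units.torsion K := by
  refine le_antisymm (sup_le_sup_right ?_ _) (sup_le h.generate le_sup_right)
  rw [Subgroup.closure_le]
  rintro _ ⟨j, rfl⟩
  exact h.mem j

/-- The regulator does not depend on the choice of the units and places. -/
theorem rayRegulator_eq {q : Ideal (𝓞 K)} {η : Fin (Units.rank K) → (𝓞 K)ˣ}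
    (h : IsRayFundSystem q η) (w₀ : InfinitePlace K)
    (σ : Fin (Units.rank K) ≃ {w : InfinitePlace K // w ≠ w₀}) :
    rayRegulator q = unitDet w₀ σ η := by
  have hex : ∃ η, IsRayFundSystem q η := ⟨η, h⟩
  have key : ∀ {θ}, IsRayFundSystem q θ → Units.regOfFamily θ =
      (rayUnits q ⊔ Units.torsion K).index * Units.regulator K := fun {θ} hθ ↦ by
    rw [← hθ.sup_eq, ← Units.regOfFamily_div_regulator,
      div_mul_cancel₀ _ (Units.regulator_ne_zero K)]
  rw [rayRegulator, dif_pos hex, unitDet_eq_regOfFamily, unitDet_eq_regOfFamily,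
    key hex.choose_spec, key h]

/-- A fixed power of every unit lies in `U_{𝔮_1}`. -/
theorem exists_pow_mem_rayUnits {q : Ideal (𝓞 K)} (hq : q ≠ ⊥) :
    ∃ n : ℕ, n ≠ 0 ∧ ∀ u : (𝓞 K)ˣ, u ^ n ∈ rayUnits q := by
  classical
  have hfin : Finite (𝓞 K ⧸ q) := Ideal.finiteQuotientOfFreeOfNeBot q hq
  refine ⟨2 * Nat.card (𝓞 K ⧸ q)ˣ, mul_ne_zero two_ne_zero Nat.card_pos.ne', fun u ↦ ?_⟩
  have hmem : ((u ^ (2 * Nat.card (𝓞 K ⧸ q)ˣ) : (𝓞 K)ˣ) : 𝓞 K) - 1 ∈ q := by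
    rw [← Ideal.Quotient.eq_zero_iff_mem, map_sub, map_one, sub_eq_zero, Units.val_pow_eq_pow_val,
      map_pow, mul_comm, pow_mul]
    have := congrArg Units.val
      (pow_card_eq_one' (x := Units.map (Ideal.Quotient.mk q).toMonoidHom u))
    simp only [Units.val_pow_eq_pow_val, Units.val_one] at this
    have h2 : (Ideal.Quotient.mk q (u : 𝓞 K)) ^ Nat.card (𝓞 K ⧸ q)ˣ = 1 := this
    rw [h2, one_pow]
  refine ⟨fun v hv ↦ ⟨?_, ?_⟩, fun σ ↦ ?_⟩
  · set x := u ^ (2 * Nat.card (𝓞 K ⧸ q)ˣ)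
    refine le_antisymm (v.valuation_le_one (x : 𝓞 K)) ?_
    have h1 := v.valuation_le_one (K := K) ((x⁻¹ : (𝓞 K)ˣ) : 𝓞 K)
    have h2 : v.valuation K ((x : 𝓞 K) : K) *
        v.valuation K (((x⁻¹ : (𝓞 K)ˣ) : 𝓞 K) : K) = 1 := by
      rw [← map_mul, ← map_mul, Units.mul_inv, map_one, map_one]
    exact h2.symm.le.trans (mul_le_of_le_one_right' h1)
  · have e : ((Units.map (algebraMap (𝓞 K) K).toMonoidHom
        (u ^ (2 * Nat.card (𝓞 K ⧸ q)ˣ)) : Kˣ) : K) - 1 =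
        algebraMap (𝓞 K) K (((u ^ (2 * Nat.card (𝓞 K ⧸ q)ˣ) : (𝓞 K)ˣ) : 𝓞 K) - 1) := by
      simp
    rw [e, HeightOneSpectrum.valuation_of_algebraMap, idealOrd,
      FractionalIdeal.count_coe K v hq, HeightOneSpectrum.intValuation_le_pow_iff_mem]
    have hdvd : v.asIdeal ^ (Associates.mk v.asIdeal).count (Associates.mk q).factors ∣ q := by
      rw [← Associates.mk_le_mk_iff_dvd, Associates.mk_pow,
        Associates.prime_pow_dvd_iff_le (Associates.mk_ne_zero.mpr hq) v.associates_irreducible]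
    exact Ideal.le_of_dvd hdvd hmem
  · have h0 : σ (((u : 𝓞 K) : K) ^ Nat.card (𝓞 K ⧸ q)ˣ) ≠ 0 := by
      rw [ne_eq, map_eq_zero]
      exact pow_ne_zero _ (Units.coe_ne_zero u)
    have h2 := sq_pos_of_ne_zero h0
    rw [← map_pow, ← pow_mul, mul_comm] at h2
    exact h2

set_option maxSynthPendingDepth 3 in
/-- Independent units that generate `U_{𝔮_1}` modulo the roots of unity exist. -/
theorem exists_isRayFundSystem {q : Ideal (𝓞 K)} (hq : q ≠ ⊥) :
    ∃ η, IsRayFundSystem q η := by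
  classical
  obtain ⟨n, hn, hpow⟩ := exists_pow_mem_rayUnits hq
  let f₀ := QuotientGroup.mk' (Units.torsion K)
  let N : Submodule ℤ (Additive ((𝓞 K)ˣ ⧸ Units.torsion K)) :=
    AddSubgroup.toIntSubmodule (Subgroup.toAddSubgroup ((rayUnits q).map f₀))
  have hN : ∀ x, n • x ∈ N := by
    intro x
    obtain ⟨u, hu⟩ := QuotientGroup.mk_surjective (Additive.toMul x)
    refine ⟨u ^ n, hpow u, ?_⟩
    rw [map_pow]
    change (QuotientGroup.mk u : (𝓞 K)ˣ ⧸ Units.torsion K) ^ n = _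
    rw [hu]; rfl
  have hrank : Module.finrank ℤ N = Units.rank K := by
    rw [← Units.finrank_modTorsion K]
    refine le_antisymm (Submodule.finrank_le N) ?_
    let f : Additive ((𝓞 K)ˣ ⧸ Units.torsion K) →ₗ[ℤ] N :=
      { toFun := fun x ↦ ⟨n • x, hN x⟩
        map_add' := fun x y ↦ Subtype.ext (smul_add n x y)
        map_smul' := fun c x ↦ Subtype.ext (smul_comm n c x) }
    refine LinearMap.finrank_le_finrank_of_injective (f := f) ?_
    intro x y hxy
    have h : n • x = n • y := congrArg Subtype.val hxy
    refine smul_right_injective (R := ℤ) _ (Nat.cast_ne_zero.mpr hn) ?_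
    simpa using h
  let b : Module.Basis (Fin (Units.rank K)) ℤ N := Module.finBasisOfFinrankEq ℤ N hrank
  have hb : ∀ j, ∃ u ∈ rayUnits q, f₀ u = Additive.toMul (b j).1 := fun j ↦ (b j).2
  choose η hη hηb using hb
  have hprod : ∀ m : Fin (Units.rank K) → ℤ,
      Additive.ofMul (f₀ (∏ j, η j ^ m j)) = ((∑ j, m j • b j : N) : Additive _) := by
    intro m
    rw [map_prod, ofMul_prod, Submodule.coe_sum]
    refine Finset.sum_congr rfl fun j _ ↦ ?_
    rw [map_zpow, hηb]; rfl
  refine ⟨η, hη, fun m hm ↦ ?_, fun u hu ↦ ?_⟩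
  · have h := hprod m
    rw [hm, map_one] at h
    have h0 : ∑ j, m j • b j = 0 := Subtype.ext h.symm
    exact funext (Fintype.linearIndependent_iff.mp b.linearIndependent m h0)
  · let x : N := ⟨Additive.ofMul (f₀ u), u, hu, rfl⟩
    have h := hprod (b.repr x)
    rw [b.sum_repr] at h
    have h' : f₀ (∏ j, η j ^ b.repr x j) = f₀ u := h
    have ht : (∏ j, η j ^ b.repr x j)⁻¹ * u ∈ Units.torsion K := QuotientGroup.eq.mp h'
    rw [← mul_inv_cancel_left (∏ j, η j ^ b.repr x j) u]
    refine Subgroup.mul_mem_sup (Subgroup.prod_mem _ fun j _ ↦ ?_) ht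
    exact Subgroup.zpow_mem _ (Subgroup.subset_closure (Set.mem_range_self j)) _

end

end RayClass

/-! Write `U` for `rayUnits q` and `μ` for the roots of unity. Everything reduces to counting
indices. The units defining the ray regulator generate `Uμ` modulo torsion, so the regulator is
`R_K` times `[𝓞ˣ : Uμ]` (`rayRegulator_eq_index_mul`), and `[𝓞ˣ : Uμ] |μ| = [𝓞ˣ : U] |U ∩ μ|`
(`index_sup_torsion_mul_torsionOrder`).

The core is `narrowRayClassNumber_mul_index_rayUnits`: `h_𝔮 [𝓞ˣ : U] = 2^{r₁} φ(𝔮) h_K`. Every ideal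
class meets `coprimeIdeals q`, which accounts for `h_K`. The rest is the index of `oneModStar q` in
the elements prime to `q`. It is `2^{r₁} φ(𝔮)` because residues modulo `q` and signs can be
prescribed independently (`relIndex_oneModStar_coprimeElements`).

This gives the regulator quotient; the analytic class number formula then turns it into the identity
with the zeta residue. -/

/-! ### The Euler function and congruences modulo `q` -/

/-- If the units of a finite ring `R` are the elements outside the kernel of a surjection onto
`S`, then `#Rˣ = #R (1 - 1 / #S)`. -/
theorem Nat.card_units_of_surjective {R S : Type*} [CommRing R] [CommRing S] [Finite R]
    {f : R →+* S} (hf : Function.Surjective f) (h : ∀ x, IsUnit x ↔ f x ≠ 0) :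
    (Nat.card Rˣ : ℝ) = Nat.card R * (1 - 1 / (Nat.card S : ℝ)) := by
  classical
  have : Finite S := Finite.of_surjective f hf
  have hS : (Nat.card S : ℝ) ≠ 0 := Nat.cast_ne_zero.mpr Nat.card_pos.ne'
  have h1 : Nat.card f.toAddMonoidHom.ker * Nat.card S = Nat.card R := by
    rw [← AddSubgroup.card_mul_index f.toAddMonoidHom.ker, AddSubgroup.index_ker,
      AddMonoidHom.range_eq_top.mpr hf, AddSubgroup.card_top]
  have e : Rˣ ≃ {x : R // ¬ x ∈ f.toAddMonoidHom.ker} :=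
    Equiv.ofBijective (fun u ↦ ⟨u, (h u).mp u.isUnit⟩) ⟨fun u v huv ↦ by
      exact Units.ext (congrArg Subtype.val huv), fun x ↦ by
      obtain ⟨u, hu⟩ := (h x).mpr x.2
      exact ⟨u, Subtype.ext hu⟩⟩
  have h2 : Nat.card f.toAddMonoidHom.ker + Nat.card Rˣ = Nat.card R := by
    rw [Nat.card_congr e, ← Nat.card_congr (Equiv.sumCompl (· ∈ f.toAddMonoidHom.ker)),
      Nat.card_sum]
  have h1' : (Nat.card f.toAddMonoidHom.ker : ℝ) * Nat.card S = Nat.card R := mod_cast h1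
  have h2' : (Nat.card f.toAddMonoidHom.ker : ℝ) + Nat.card Rˣ = Nat.card R := mod_cast h2
  rw [← h1'] at h2' ⊢
  field_simp
  linear_combination h2'

namespace RayClass

variable {K : Type*} [Field K] [NumberField K]

/-- An element of `𝓞 K ⧸ p ^ e` is a unit exactly when its image in the residue field `𝓞 K ⧸ p` is
nonzero. -/
theorem card_units_quotient_prime_pow {p : Ideal (𝓞 K)} (hp : p.IsPrime) (hp0 : p ≠ ⊥) {e : ℕ}
    (he : e ≠ 0) :
    (Nat.card (𝓞 K ⧸ p ^ e)ˣ : ℝ) =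
      (Ideal.absNorm (p ^ e) : ℝ) * (1 - 1 / (Ideal.absNorm p : ℝ)) := by
  have : p.IsMaximal := hp.isMaximal hp0
  have : Finite (𝓞 K ⧸ p ^ e) := Ideal.finiteQuotientOfFreeOfNeBot _ (pow_ne_zero e hp0)
  refine Nat.card_units_of_surjective (S := 𝓞 K ⧸ p)
    (f := Ideal.Quotient.factor (Ideal.pow_le_self he))
    (Ideal.Quotient.factor_surjective _) fun x ↦ ?_
  obtain ⟨x, rfl⟩ := Ideal.Quotient.mk_surjective x
  refine (Ideal.Quotient.isUnit_mk_pow_iff_notMem p he).trans ?_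
  rw [Ideal.Quotient.factor_mk, ne_eq, Ideal.Quotient.eq_zero_iff_mem]

/-- By the Chinese remainder theorem the unit group is a product over the prime power factors of
`q`. -/
theorem card_units_quotient {q : Ideal (𝓞 K)} (hq : q ≠ ⊥) :
    (Nat.card (𝓞 K ⧸ q)ˣ : ℝ) = idealPhi q := by
  classical
  have hf : UniqueFactorizationMonoid.factors q =
      UniqueFactorizationMonoid.normalizedFactors q :=
    UniqueFactorizationMonoid.factors_eq_normalizedFactors q
  rw [Nat.card_congr ((Units.mapEquiv (quotientEquivPiFactors hq).toMulEquiv).trans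
    MulEquiv.piUnits).toEquiv, Nat.card_pi, Nat.cast_prod]
  have h : ∀ P : (UniqueFactorizationMonoid.factors q).toFinset,
      (Nat.card (𝓞 K ⧸ (P : Ideal (𝓞 K)) ^
        Multiset.count (P : Ideal (𝓞 K)) (UniqueFactorizationMonoid.factors q))ˣ : ℝ) =
      (Ideal.absNorm ((P : Ideal (𝓞 K)) ^
        Multiset.count (P : Ideal (𝓞 K)) (UniqueFactorizationMonoid.factors q)) : ℝ) *
        (1 - 1 / (Ideal.absNorm (P : Ideal (𝓞 K)) : ℝ)) := fun P ↦ by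
    have hP := Multiset.mem_toFinset.mp P.2
    have hpp := UniqueFactorizationMonoid.prime_of_factor _ hP
    exact card_units_quotient_prime_pow (Ideal.isPrime_of_prime hpp) hpp.ne_zero
      (Multiset.count_ne_zero.mpr hP)
  rw [Finset.prod_congr rfl fun P _ ↦ h P, Finset.prod_mul_distrib, idealPhi]
  congr 1
  · rw [← Nat.cast_prod, ← map_prod,
      Finset.prod_coe_sort (UniqueFactorizationMonoid.factors q).toFinset
        (fun P ↦ P ^ Multiset.count P (UniqueFactorizationMonoid.factors q)),
      ← Finset.prod_multiset_count,
      associated_iff_eq.mp (UniqueFactorizationMonoid.factors_prod hq)]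
  · rw [Finset.prod_coe_sort (UniqueFactorizationMonoid.factors q).toFinset
        (fun P ↦ (1 - 1 / (Ideal.absNorm P : ℝ))), hf]

theorem mem_iff_forall_valuation_le {q : Ideal (𝓞 K)} (hq : q ≠ ⊥) (z : 𝓞 K) :
    z ∈ q ↔ ∀ v : HeightOneSpectrum (𝓞 K), v.asIdeal ∣ q →
      v.valuation K (z : K) ≤ WithZero.exp (-idealOrd v (q : FractionalIdeal (𝓞 K)⁰ K)) := by
  classical
  simp only [HeightOneSpectrum.valuation_of_algebraMap, idealOrd,
      FractionalIdeal.count_coe K _ hq, HeightOneSpectrum.intValuation_le_pow_iff_mem]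
  refine ⟨fun hz v hv ↦ ?_, fun h ↦ ?_⟩
  · have hdvd : v.asIdeal ^ (Associates.mk v.asIdeal).count (Associates.mk q).factors ∣ q := by
      rw [← Associates.mk_le_mk_iff_dvd, Associates.mk_pow,
        Associates.prime_pow_dvd_iff_le (Associates.mk_ne_zero.mpr hq) v.associates_irreducible]
    exact Ideal.le_of_dvd hdvd hz
  -- Divisibility `q ∣ (z)` is compared through multiplicities of prime factors, which needs `z ≠
  -- 0`.
  · by_cases hz : z = 0
    · rw [hz]; exact q.zero_mem
    have hz' : Ideal.span {z} ≠ ⊥ := by simpa using hz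
    rw [← Ideal.dvd_span_singleton,
      UniqueFactorizationMonoid.dvd_iff_normalizedFactors_le_normalizedFactors hq hz',
      Multiset.le_iff_count]
    intro p
    by_cases hp : p ∈ UniqueFactorizationMonoid.normalizedFactors q
    · have hpp := UniqueFactorizationMonoid.prime_of_normalized_factor p hp
      let v : HeightOneSpectrum (𝓞 K) := ⟨p, Ideal.isPrime_of_prime hpp, hpp.ne_zero⟩
      have := h v (UniqueFactorizationMonoid.dvd_of_mem_normalizedFactors hp)
      rw [← Ideal.count_associates_factors_eq hq v.isPrime v.ne_bot,
        ← Ideal.count_associates_factors_eq hz' v.isPrime v.ne_bot,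
        ← Associates.prime_pow_dvd_iff_le (Associates.mk_ne_zero.mpr hz') v.associates_irreducible,
        ← Associates.mk_pow, Associates.mk_le_mk_iff_dvd, Ideal.dvd_span_singleton]
      exact this
    · rw [Multiset.count_eq_zero_of_notMem hp]; exact Nat.zero_le _

/-- A non-unit would put `z` and `q` into a common maximal ideal, and since `q ≠ ⊥` that ideal is a
prime of height one. -/
theorem isUnit_mk_iff_forall_valuation_eq_one {q : Ideal (𝓞 K)} (hq : q ≠ ⊥) (z : 𝓞 K) :
    IsUnit (Ideal.Quotient.mk q z) ↔
      ∀ v : HeightOneSpectrum (𝓞 K), v.asIdeal ∣ q → v.valuation K (z : K) = 1 := by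
  simp only [HeightOneSpectrum.valuation_eq_one_iff_notMem]
  constructor
  · intro hz v hv hzv
    obtain ⟨y, hy⟩ := hz.exists_right_inv
    obtain ⟨y, rfl⟩ := Ideal.Quotient.mk_surjective y
    rw [← map_mul, ← map_one (Ideal.Quotient.mk q), Ideal.Quotient.eq] at hy
    refine v.isPrime.ne_top ((Ideal.eq_top_iff_one _).mpr ?_)
    simpa using sub_mem (v.asIdeal.mul_mem_right y hzv) (Ideal.le_of_dvd hv hy)
  · intro h
    have htop : q ⊔ Ideal.span {z} = ⊤ := by
      by_contra hne
      obtain ⟨m, hm, hle⟩ := Ideal.exists_le_maximal _ hne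
      have hqm : q ≤ m := le_sup_left.trans hle
      exact h ⟨m, hm.isPrime, fun h0 ↦ hq (le_bot_iff.mp (h0 ▸ hqm))⟩ (Ideal.dvd_iff_le.mpr hqm)
        (hle (Ideal.mem_sup_right (Ideal.mem_span_singleton_self z)))
    obtain ⟨x, hx, y, hy, hxy⟩ := Submodule.mem_sup.mp ((Ideal.eq_top_iff_one _).mp htop)
    obtain ⟨c, rfl⟩ := Ideal.mem_span_singleton'.mp hy
    refine IsUnit.of_mul_eq_one (Ideal.Quotient.mk q c) ?_
    rw [← map_mul, ← map_one (Ideal.Quotient.mk q), Ideal.Quotient.eq, mul_comm z,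
      ← neg_mem_iff, ← hxy]
    simpa using hx

end RayClass

/-! ### Prescribing signs at the real embeddings -/

namespace RayClass

variable {K : Type*} [Field K]

/-- The infinite place below a real embedding. -/
noncomputable abbrev realPlace (σ : K →+* ℝ) : InfinitePlace K :=
  InfinitePlace.mk (Complex.ofRealHom.comp σ)

theorem realPlace_apply (σ : K →+* ℝ) (x : K) : realPlace σ x = |σ x| := by
  simp [realPlace]

theorem isReal_ofRealHom_comp (σ : K →+* ℝ) :
    ComplexEmbedding.IsReal (Complex.ofRealHom.comp σ) := by
  ext x
  simp [ComplexEmbedding.conjugate_coe_eq]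

theorem realPlace_injective : Function.Injective (realPlace (K := K)) := by
  intro σ τ h
  rw [realPlace, realPlace, InfinitePlace.mk_eq_iff,
    ComplexEmbedding.isReal_iff.mp (isReal_ofRealHom_comp σ), or_self] at h
  ext x
  exact Complex.ofReal_injective (RingHom.congr_fun h x)

variable [NumberField K]

theorem card_ringHom_real : Nat.card (K →+* ℝ) = InfinitePlace.nrRealPlaces K := by
  classical
  rw [← InfinitePlace.card_real_embeddings, ← Nat.card_eq_fintype_card]
  refine Nat.card_congr (Equiv.ofBijective (fun σ ↦ ⟨_, isReal_ofRealHom_comp σ⟩) ⟨?_, ?_⟩)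
  · intro σ τ h
    ext x
    exact Complex.ofReal_injective (RingHom.congr_fun (congrArg Subtype.val h) x)
  · rintro ⟨φ, hφ⟩
    exact ⟨hφ.embedding, Subtype.ext (RingHom.ext fun x ↦ hφ.coe_embedding_apply x)⟩

/-- There are elements of `K` with prescribed signs at the real embeddings. -/
theorem exists_forall_pos_iff (s : Set (K →+* ℝ)) :
    ∃ t : K, t ≠ 0 ∧ ∀ σ, 0 < σ t ↔ σ ∈ s := by
  classical
  -- Weak approximation: an element at distance less than `1` from `±1` at a real place has that
  -- sign. The value at complex places is immaterial.
  let a : InfinitePlace K → K := fun v ↦ if ∃ σ ∈ s, realPlace σ = v then 1 else -1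
  have hopen : IsOpen {x : (v : InfinitePlace K) → WithAbs v.1 |
      ∀ v, ‖x v - WithAbs.toAbs v.1 (a v)‖ < 1} := by
    rw [Set.ofPred_forall]
    exact isOpen_iInter_of_finite fun v ↦
      isOpen_lt (((continuous_apply v).sub continuous_const).norm) continuous_const
  obtain ⟨t, ht⟩ := (InfinitePlace.denseRange_algebraMap_pi K).exists_mem_open hopen
    ⟨fun v ↦ WithAbs.toAbs v.1 (a v), fun v ↦ by simp⟩
  have ht' : ∀ v : InfinitePlace K, v (t - a v) < 1 := fun v ↦ ht v
  refine ⟨t, ?_, fun σ ↦ ?_⟩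
  -- Zero has distance exactly `1` from `±1`. Any infinite place will do, so no real embedding is
  -- needed.
  · rintro rfl
    obtain ⟨v⟩ : Nonempty (InfinitePlace K) := inferInstance
    have := ht' v
    simp only [a] at this
    split_ifs at this <;> simp [← InfinitePlace.norm_embedding_eq] at this
  · have h := ht' (realPlace σ)
    rw [realPlace_apply, abs_lt, map_sub] at h
    by_cases hs : σ ∈ s
    · have : a (realPlace σ) = 1 := if_pos ⟨σ, hs, rfl⟩
      rw [this, map_one] at h
      exact iff_of_true (by linarith [h.1]) hs
    · have : a (realPlace σ) = -1 := if_neg fun ⟨τ, hτ, e⟩ ↦ hs (realPlace_injective e ▸ hτ)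
      rw [this, map_neg, map_one] at h
      exact iff_of_false (by linarith [h.2]) hs

/-- There are algebraic integers with prescribed signs at the real embeddings. -/
theorem exists_integer_forall_pos_iff (s : Set (K →+* ℝ)) :
    ∃ t : 𝓞 K, t ≠ 0 ∧ ∀ σ : K →+* ℝ, 0 < σ t ↔ σ ∈ s := by
  obtain ⟨t, ht0, ht⟩ := exists_forall_pos_iff s
  obtain ⟨a, b, hb, rfl⟩ := IsFractionRing.div_surjective (A := 𝓞 K) t
  have hb0 : b ≠ 0 := nonZeroDivisors.ne_zero hb
  have ha0 : a ≠ 0 := by rintro rfl; simp at ht0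
  -- The product `a * b` has the same signs as `a / b`.
  refine ⟨a * b, mul_ne_zero ha0 hb0, fun σ ↦ ?_⟩
  change 0 < σ (algebraMap (𝓞 K) K (a * b)) ↔ _
  rw [← ht σ, map_div₀, map_mul, map_mul, div_pos_iff, mul_pos_iff]

/-- There are algebraic integers with prescribed residue modulo `q` and prescribed signs. -/
theorem exists_sub_mem_forall_pos_iff {q : Ideal (𝓞 K)} (hq : q ≠ ⊥) (x : 𝓞 K)
    (s : Set (K →+* ℝ)) :
    ∃ y : 𝓞 K, y ≠ 0 ∧ y - x ∈ q ∧ ∀ σ : K →+* ℝ, 0 < σ y ↔ σ ∈ s := by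
  -- The witness is `x + N * t * M` with `N` the norm of `q`: since `N ∈ q` the residue of `x` is
  -- kept, and for large `M` the signs are those of `t`.
  obtain ⟨t, ht0, ht⟩ := exists_integer_forall_pos_iff s
  have hN0 : Ideal.absNorm q ≠ 0 := Ideal.absNorm_eq_zero_iff.not.mpr hq
  set N := Ideal.absNorm q
  have hNq : (N : 𝓞 K) ∈ q := Ideal.absNorm_mem q
  have hNt : (N : 𝓞 K) * t ≠ 0 := mul_ne_zero (Nat.cast_ne_zero.mpr hN0) ht0
  have h1 : ∀ᶠ M : ℕ in atTop, x + N * t * M ≠ 0 := by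
    rw [← Nat.cofinite_eq_atTop]
    refine Set.Subsingleton.finite fun M hM M' hM' ↦ ?_
    have e := (not_not.mp hM).trans (not_not.mp hM').symm
    exact Nat.cast_injective (mul_left_cancel₀ hNt (add_left_cancel e))
  have h2 : ∀ σ : K →+* ℝ, ∀ᶠ M : ℕ in atTop,
      (0 < σ ((x + N * t * M : 𝓞 K) : K) ↔ σ ∈ s) := by
    intro σ
    have e : ∀ M : ℕ, σ ((x + N * t * M : 𝓞 K) : K) = σ x + (N * σ t) * M := fun M ↦ by
      simp
    simp only [e]
    have hNpos : (0 : ℝ) < N := Nat.cast_pos.mpr (Nat.pos_of_ne_zero hN0)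
    have hσt : σ t ≠ 0 := by simpa using ht0
    by_cases hs : σ ∈ s
    · have := tendsto_atTop_add_const_left atTop (σ x)
        ((tendsto_natCast_atTop_atTop (R := ℝ)).const_mul_atTop (mul_pos hNpos ((ht σ).mpr hs)))
      filter_upwards [this.eventually_gt_atTop 0] with M hM using iff_of_true hM hs
    · have hneg : σ t < 0 := lt_of_le_of_ne (not_lt.mp ((ht σ).not.mpr hs)) hσt
      have := tendsto_atBot_add_const_left atTop (σ x)
        ((tendsto_natCast_atTop_atTop (R := ℝ)).const_mul_atTop_of_neg
          (mul_neg_of_pos_of_neg hNpos hneg))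
      filter_upwards [this.eventually_lt_atBot 0] with M hM using iff_of_false hM.not_gt hs
  have : Finite (K →+* ℝ) := Finite.of_injective _ realPlace_injective
  obtain ⟨M, hM, hM'⟩ := (h1.and (eventually_all.mpr h2)).exists
  refine ⟨_, hM, ?_, hM'⟩
  rw [add_sub_cancel_left, mul_assoc]
  exact q.mul_mem_right _ hNq

end RayClass

/-! ### The index of `oneModStar q` in the elements prime to `q` -/

theorem Nat.card_eq_of_surjective_of_iff {α β γ : Type*} {f : α → β} {g : α → γ}
    (hf : Function.Surjective f) (hg : Function.Surjective g)
    (h : ∀ x y, f x = f y ↔ g x = g y) : Nat.card β = Nat.card γ := by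
  refine Nat.card_congr (Equiv.ofBijective (fun b ↦ g (Function.surjInv hf b)) ⟨?_, ?_⟩)
  · intro b b' hb
    simpa [Function.surjInv_eq hf] using (h _ _).mpr hb
  · intro c
    obtain ⟨x, rfl⟩ := hg c
    exact ⟨f x, (h _ _).mp (Function.surjInv_eq hf (f x))⟩

namespace RayClass

variable {K : Type*} [Field K] [NumberField K]

theorem idealOrd_spanSingleton_eq_zero_iff (v : HeightOneSpectrum (𝓞 K)) {x : K} (hx : x ≠ 0) :
    idealOrd v (FractionalIdeal.spanSingleton (𝓞 K)⁰ x) = 0 ↔ v.valuation K x = 1 := by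
  classical
  obtain ⟨a, b, hb, rfl⟩ := IsFractionRing.div_surjective (A := 𝓞 K) x
  have hb0 : b ≠ 0 := nonZeroDivisors.ne_zero hb
  have ha0 : a ≠ 0 := by rintro rfl; simp at hx
  rw [idealOrd, FractionalIdeal.count_well_defined K v (a := b) (J := Ideal.span {a})
    (FractionalIdeal.spanSingleton_ne_zero_iff.mpr hx), map_div₀,
    HeightOneSpectrum.valuation_of_algebraMap, HeightOneSpectrum.valuation_of_algebraMap,
    v.intValuation_if_neg ha0, v.intValuation_if_neg hb0, ← WithZero.exp_sub,
    ← WithZero.exp_zero, WithZero.exp_inj]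
  · omega
  · rw [FractionalIdeal.coeIdeal_span_singleton, FractionalIdeal.spanSingleton_mul_spanSingleton,
      div_eq_inv_mul]

/-- The group of the elements of `Kˣ` that are prime to `q`. -/
def coprimeElements (q : Ideal (𝓞 K)) : Subgroup Kˣ :=
  (coprimeIdeals q).comap (toPrincipalIdeal (𝓞 K) K)

theorem mem_coprimeElements_iff {q : Ideal (𝓞 K)} {α : Kˣ} :
    α ∈ coprimeElements q ↔
      ∀ v : HeightOneSpectrum (𝓞 K), v.asIdeal ∣ q → v.valuation K (α : K) = 1 := by
  refine forall₂_congr fun v _ ↦ ?_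
  rw [coe_toPrincipalIdeal, idealOrd_spanSingleton_eq_zero_iff v α.ne_zero]

theorem oneModStar_le_coprimeElements (q : Ideal (𝓞 K)) : oneModStar q ≤ coprimeElements q :=
  fun _ hα ↦ mem_coprimeElements_iff.mpr fun v hv ↦ (hα.1 v hv).1

theorem isOneModStar_inv_mul_iff {q : Ideal (𝓞 K)} (hq : q ≠ ⊥) {x y : 𝓞 K} (hx0 : x ≠ 0)
    (hy0 : y ≠ 0) (hx : IsUnit (Ideal.Quotient.mk q x)) (hy : IsUnit (Ideal.Quotient.mk q y)) :
    IsOneModStar q ((x : K)⁻¹ * y) ↔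
      y - x ∈ q ∧ ∀ σ : K →+* ℝ, (0 < σ y ↔ 0 < σ x) := by
  have hx0' : (x : K) ≠ 0 := by simpa using hx0
  have hxv := (isUnit_mk_iff_forall_valuation_eq_one hq x).mp hx
  have hyv := (isUnit_mk_iff_forall_valuation_eq_one hq y).mp hy
  refine and_congr ?_ (forall_congr' fun σ ↦ ?_)
  · rw [mem_iff_forall_valuation_le hq]
    refine forall₂_congr fun v hv ↦ ?_
    -- The factor `x⁻¹` has valuation `1` at the primes dividing `q`, so only `y - x` counts.
    have e : (x : K)⁻¹ * y - 1 = (x : K)⁻¹ * ((y - x : 𝓞 K) : K) := by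
      push_cast; field_simp
    rw [e, map_mul, map_mul, map_inv₀, hxv v hv, hyv v hv, inv_one, one_mul, one_mul,
      and_iff_right rfl]
  · have hσx : σ x ≠ 0 := by simpa using hx0
    have hσy : σ y ≠ 0 := by simpa using hy0
    rw [map_mul, map_inv₀, inv_mul_eq_div, div_pos_iff]
    grind

/-- The ideal `J` of denominators of `α` is coprime to `q`, because `α` is integral at every prime
dividing `q`. Hence `J` contains some `b ≡ 1` modulo `q`. -/
theorem exists_mul_eq_algebraMap {q : Ideal (𝓞 K)} (hq : q ≠ ⊥) {α : K}
    (hα : ∀ v : HeightOneSpectrum (𝓞 K), v.asIdeal ∣ q → v.valuation K α = 1) :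
    ∃ a b : 𝓞 K, b ≠ 0 ∧ IsUnit (Ideal.Quotient.mk q b) ∧ (b : K) * α = a := by
  let J : Ideal (𝓞 K) := (1 : Submodule (𝓞 K) K).comap (LinearMap.toSpanSingleton (𝓞 K) K α)
  have hJ : ∀ b, b ∈ J ↔ ∃ a : 𝓞 K, (b : K) * α = a := fun b ↦ by
    simp only [J, Submodule.mem_comap, LinearMap.toSpanSingleton_apply, Submodule.mem_one,
      Algebra.smul_def]
    exact exists_congr fun a ↦ eq_comm
  have htop : J ⊔ q = ⊤ := by
    by_contra hne
    obtain ⟨m, hm, hle⟩ := Ideal.exists_le_maximal _ hne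
    have hqm : q ≤ m := le_sup_right.trans hle
    let v : HeightOneSpectrum (𝓞 K) :=
      ⟨m, hm.isPrime, fun h0 ↦ hq (le_bot_iff.mp (h0 ▸ hqm))⟩
    obtain ⟨n, d, hd⟩ := HeightOneSpectrum.exists_primeCompl_mul_eq_of_integer v α
      (hα v (Ideal.dvd_iff_le.mpr hqm)).le
    refine d.2 (hle (Ideal.mem_sup_left ((hJ d).mpr ⟨n, ?_⟩)))
    rw [mul_comm]; exact hd
  obtain ⟨b, hb, c, hc, hbc⟩ := Submodule.mem_sup.mp ((Ideal.eq_top_iff_one _).mp htop)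
  obtain ⟨a, ha⟩ := (hJ b).mp hb
  -- The denominator `b` can vanish only for `q = ⊤`, where any nonzero denominator serves.
  by_cases hb0 : b = 0
  · have hqt : q = ⊤ := by rwa [Ideal.eq_top_iff_one, ← hbc, hb0, zero_add]
    subst hqt
    obtain ⟨a', b', hb', rfl⟩ := IsFractionRing.div_surjective (A := 𝓞 K) α
    have hb0' : (b' : K) ≠ 0 := by simpa using nonZeroDivisors.ne_zero hb'
    have : Subsingleton (𝓞 K ⧸ (⊤ : Ideal (𝓞 K))) := Ideal.Quotient.subsingleton_iff.mpr rfl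
    exact ⟨a', b', nonZeroDivisors.ne_zero hb', isUnit_of_subsingleton _,
      mul_div_cancel₀ _ hb0'⟩
  · refine ⟨a, b, hb0, ?_, ha⟩
    have : Ideal.Quotient.mk q b = 1 := by
      rw [← map_one (Ideal.Quotient.mk q), Ideal.Quotient.eq, ← hbc, sub_add_cancel_left,
        neg_mem_iff]
      exact hc
    rw [this]; exact isUnit_one

/-- Nonzero integers prime to `q` map onto pairs (set of positive embeddings, residue class) by `f`
and onto the quotient group by `g`. The two maps have the same fibres, so their targets have equal
size. -/
theorem relIndex_oneModStar_coprimeElements {q : Ideal (𝓞 K)} (hq : q ≠ ⊥) :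
    (oneModStar q).relIndex (coprimeElements q) =
      2 ^ InfinitePlace.nrRealPlaces K * Nat.card (𝓞 K ⧸ q)ˣ := by
  classical
  have hfin : Finite (K →+* ℝ) := Finite.of_injective _ realPlace_injective
  -- The condition `x ≠ 0` is not automatic: for `q = ⊤` the class of `0` is a unit.
  let S := {x : 𝓞 K // x ≠ 0 ∧ IsUnit (Ideal.Quotient.mk q x)}
  let f : S → Set (K →+* ℝ) × (𝓞 K ⧸ q)ˣ := fun x ↦ ({σ | 0 < σ x.1}, x.2.2.unit)
  let u : S → Kˣ := fun x ↦ Units.mk0 (x.1 : K) (by simpa using x.2.1)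
  have hu : ∀ x, u x ∈ coprimeElements q := fun x ↦
    mem_coprimeElements_iff.mpr ((isUnit_mk_iff_forall_valuation_eq_one hq x.1).mp x.2.2)
  let g : S → coprimeElements q ⧸ (oneModStar q).subgroupOf (coprimeElements q) :=
    fun x ↦ QuotientGroup.mk ⟨u x, hu x⟩
  have hfg : ∀ x y, f x = f y ↔ g x = g y := fun x y ↦ by
    rw [QuotientGroup.eq, Subgroup.mem_subgroupOf]
    have h := isOneModStar_inv_mul_iff hq x.2.1 y.2.1 x.2.2 y.2.2
    have e : ((⟨u x, hu x⟩⁻¹ * ⟨u y, hu y⟩ : coprimeElements q) : Kˣ) ∈ oneModStar q ↔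
        IsOneModStar q ((x.1 : K)⁻¹ * y.1) := by
      change IsOneModStar q (((u x)⁻¹ * u y : Kˣ) : K) ↔ _
      simp [u]
    rw [e, h, Prod.ext_iff, and_comm, Set.ext_iff, Units.ext_iff]
    refine and_congr ?_ (forall_congr' fun σ ↦ Iff.comm)
    simp only [f, IsUnit.unit_spec]
    rw [eq_comm, Ideal.Quotient.eq]
  have hf : Function.Surjective f := by
    rintro ⟨s, c⟩
    obtain ⟨x, hx⟩ := Ideal.Quotient.mk_surjective c.1
    obtain ⟨y, hy0, hyx, hy⟩ := exists_sub_mem_forall_pos_iff hq x s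
    have hyc : Ideal.Quotient.mk q y = c := by rw [← hx, Ideal.Quotient.eq]; exact hyx
    refine ⟨⟨y, hy0, hyc ▸ c.isUnit⟩, Prod.ext (Set.ext hy) (Units.ext hyc)⟩
  have hg : Function.Surjective g := by
    intro c
    obtain ⟨⟨α, hα⟩, rfl⟩ := QuotientGroup.mk_surjective c
    have hα' := mem_coprimeElements_iff.mp hα
    obtain ⟨a, b, hb0, hb, hab⟩ := exists_mul_eq_algebraMap hq hα'
    have hb0' : (b : K) ≠ 0 := by simpa using hb0
    have ha0 : a ≠ 0 := by
      rintro rfl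
      simp [hb0] at hab
    have ha : IsUnit (Ideal.Quotient.mk q a) := by
      rw [isUnit_mk_iff_forall_valuation_eq_one hq] at hb ⊢
      intro v hv
      rw [← hab, map_mul, hb v hv, hα' v hv, one_mul]
    -- With `α = a / b`, choose an integer `x` with residue `a / b` and the signs of `α`; then `x`
    -- and `α` are compared through `b * x` and `a`.
    obtain ⟨x, hx⟩ := hf ({σ | 0 < σ (α : K)}, hb.unit⁻¹ * ha.unit)
    have hxq : Ideal.Quotient.mk q x.1 = ((hb.unit⁻¹ * ha.unit : (𝓞 K ⧸ q)ˣ) : 𝓞 K ⧸ q) :=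
      congrArg (fun z ↦ (z.2 : 𝓞 K ⧸ q)) hx
    have hxs : ∀ σ : K →+* ℝ, 0 < σ x.1 ↔ 0 < σ (α : K) :=
      fun σ ↦ Set.ext_iff.mp (congrArg Prod.fst hx) σ
    refine ⟨x, ?_⟩
    rw [QuotientGroup.eq, Subgroup.mem_subgroupOf]
    change IsOneModStar q (((u x)⁻¹ * α : Kˣ) : K)
    have e : (((u x)⁻¹ * α : Kˣ) : K) = (((b * x.1 : 𝓞 K) : K))⁻¹ * a := by
      have hbx : ((b * x.1 : 𝓞 K) : K) = b * x.1 := map_mul _ _ _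
      rw [← hab, hbx, mul_inv, mul_comm (b : K)⁻¹, mul_assoc, inv_mul_cancel_left₀ hb0']
      rfl
    rw [e, isOneModStar_inv_mul_iff hq (mul_ne_zero hb0 x.2.1) ha0
      (by rw [map_mul]; exact hb.mul x.2.2) ha]
    constructor
    · rw [← Ideal.Quotient.eq, map_mul, hxq]
      have : hb.unit * (hb.unit⁻¹ * ha.unit) = ha.unit := mul_inv_cancel_left _ _
      exact (congrArg Units.val this).symm
    · intro σ
      have hσb : σ b ≠ 0 := by simpa using hb0
      have hσx : σ x.1 ≠ 0 := by simpa using x.2.1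
      have hσα : σ α ≠ 0 := by simp
      have h := hxs σ
      rw [← hab]
      push_cast
      simp only [map_mul, mul_pos_iff]
      clear * - hσb hσx hσα h
      grind
  rw [Subgroup.relIndex, Subgroup.index, ← Nat.card_eq_of_surjective_of_iff hf hg hfg,
    Nat.card_prod, ← card_ringHom_real]
  congr 1
  simp [Nat.card_eq_fintype_card]

end RayClass

/-! ### The class number of the ray and the index of its units -/

namespace RayClass

variable {K : Type*} [Field K] [NumberField K]

theorem ker_toPrincipalIdeal :
    (toPrincipalIdeal (𝓞 K) K).ker = (Units.map (algebraMap (𝓞 K) K).toMonoidHom).range := by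
  ext x
  rw [MonoidHom.mem_ker, MonoidHom.mem_range, toPrincipalIdeal_eq_iff, Units.val_one]
  constructor
  · intro h
    have h' : FractionalIdeal.spanSingleton (𝓞 K)⁰ (x : K)⁻¹ = 1 := by
      rw [← FractionalIdeal.spanSingleton_inv, h, inv_one]
    obtain ⟨a, ha⟩ := (FractionalIdeal.mem_one_iff (𝓞 K)⁰).mp
      (h ▸ FractionalIdeal.mem_spanSingleton_self (𝓞 K)⁰ (x : K))
    obtain ⟨b, hb⟩ := (FractionalIdeal.mem_one_iff (𝓞 K)⁰).mp
      (h' ▸ FractionalIdeal.mem_spanSingleton_self (𝓞 K)⁰ (x : K)⁻¹)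
    have hab : a * b = 1 := by
      apply FaithfulSMul.algebraMap_injective (𝓞 K) K
      rw [map_mul, ha, hb, map_one, mul_inv_cancel₀ x.ne_zero]
    exact ⟨⟨a, b, hab, mul_comm a b ▸ hab⟩, Units.ext ha⟩
  · rintro ⟨u, rfl⟩
    change FractionalIdeal.spanSingleton (𝓞 K)⁰ (algebraMap (𝓞 K) K u) = 1
    rw [← FractionalIdeal.coeIdeal_span_singleton, Ideal.span_singleton_eq_top.mpr u.isUnit,
      FractionalIdeal.coeIdeal_top]

/-- Every ideal class contains an ideal that is coprime to `q`. -/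
theorem range_sup_coprimeIdeals {q : Ideal (𝓞 K)} (hq : q ≠ ⊥) :
    (toPrincipalIdeal (𝓞 K) K).range ⊔ coprimeIdeals q = ⊤ := by
  classical
  by_cases hqt : q = ⊤
  · have : coprimeIdeals q = ⊤ := by
      refine eq_top_iff.mpr fun I _ v hv ↦ (v.isPrime.ne_top ?_).elim
      rw [hqt] at hv
      exact top_le_iff.mp (Ideal.le_of_dvd hv)
    rw [this, sup_top_eq]
  refine eq_top_iff.mpr fun I _ ↦ ?_
  -- Write `I⁻¹ = J / d` and choose `a` with `J * q + (a) = J`. Then `(a) = J * A` with `A` coprime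
  -- to `q`, and `I = (d / a) * A`.
  obtain ⟨d, J, hd0, hJ⟩ := FractionalIdeal.exists_eq_spanSingleton_mul
    ((I⁻¹ : (FractionalIdeal (𝓞 K)⁰ K)ˣ) : FractionalIdeal (𝓞 K)⁰ K)
  have hJ0 : J ≠ ⊥ := by
    rintro rfl
    exact (I⁻¹).ne_zero (by rw [hJ, FractionalIdeal.coeIdeal_bot, mul_zero])
  obtain ⟨a, ha⟩ := IsDedekindDomain.exists_sup_span_eq (I := J * q) (J := J)
    (Ideal.le_of_dvd (dvd_mul_right J q)) (mul_ne_zero hJ0 hq)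
  obtain ⟨A, hA⟩ : J ∣ Ideal.span {a} := Ideal.dvd_iff_le.mpr (le_sup_right.trans_eq ha)
  have hqA : q ⊔ A = ⊤ := by
    rw [hA, ← Ideal.mul_sup] at ha
    exact mul_left_cancel₀ hJ0 (ha.trans (Ideal.mul_top J).symm)
  have hA0 : A ≠ ⊥ := by
    rintro rfl
    exact hqt (by simpa using hqA)
  have ha0 : a ≠ 0 := by
    rintro rfl
    rw [Ideal.span_singleton_zero, eq_comm] at hA
    exact mul_ne_zero hJ0 hA0 hA
  have hd0' : (algebraMap (𝓞 K) K d) ≠ 0 := by simpa using hd0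
  have ha0' : (algebraMap (𝓞 K) K a) ≠ 0 := by simpa using ha0
  let x : Kˣ := Units.mk0 (algebraMap (𝓞 K) K d / algebraMap (𝓞 K) K a) (div_ne_zero hd0' ha0')
  let B : (FractionalIdeal (𝓞 K)⁰ K)ˣ :=
    Units.mk0 (A : FractionalIdeal (𝓞 K)⁰ K) (FractionalIdeal.coeIdeal_ne_zero.mpr hA0)
  have hIB : I = toPrincipalIdeal (𝓞 K) K x * B := by
    rw [← inv_mul_eq_one, Units.ext_iff]
    rw [Units.val_mul, Units.val_mul, coe_toPrincipalIdeal, hJ, Units.val_one]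
    simp only [x, B, Units.val_mk0]
    calc _ = FractionalIdeal.spanSingleton (𝓞 K)⁰ (algebraMap (𝓞 K) K d)⁻¹ *
          FractionalIdeal.spanSingleton (𝓞 K)⁰ (algebraMap (𝓞 K) K d / algebraMap (𝓞 K) K a) *
          ((J : FractionalIdeal (𝓞 K)⁰ K) * A) := by ring
      _ = _ := by
        rw [← FractionalIdeal.coeIdeal_mul, ← hA, FractionalIdeal.coeIdeal_span_singleton,
          FractionalIdeal.spanSingleton_mul_spanSingleton,
          FractionalIdeal.spanSingleton_mul_spanSingleton, ← FractionalIdeal.spanSingleton_one]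
        congr 1
        field_simp
  rw [hIB]
  refine Subgroup.mul_mem_sup ⟨x, rfl⟩ fun v hv ↦ ?_
  simp only [B, Units.val_mk0]
  rw [idealOrd, FractionalIdeal.count_coe K v hA0, Nat.cast_eq_zero]
  by_contra hne
  have hvA := (Associates.count_ne_zero_iff_dvd hA0 v.irreducible).mp hne
  exact v.isPrime.ne_top (top_le_iff.mp (hqA ▸ sup_le (Ideal.le_of_dvd hv) (Ideal.le_of_dvd hvA)))

theorem index_range_toPrincipalIdeal :
    (toPrincipalIdeal (𝓞 K) K).range.index = classNumber K := by
  rw [classNumber, ← Nat.card_eq_fintype_card, Subgroup.index,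
    Nat.card_congr (ClassGroup.equiv K).toEquiv]

/-- The index of `oneModStar q` in `coprimeElements q` splits at `oneModStar q ⊔ f.ker`. The upper
step is the principal part of the ray class group; the lower one is the index of `rayUnits q`, as
`f.ker` is the image of the units. -/
theorem narrowRayClassNumber_mul_index_rayUnits {q : Ideal (𝓞 K)} (hq : q ≠ ⊥) :
    narrowRayClassNumber q * (rayUnits q).index =
      2 ^ InfinitePlace.nrRealPlaces K * Nat.card (𝓞 K ⧸ q)ˣ * classNumber K := by
  set f := toPrincipalIdeal (𝓞 K) K
  have hker : f.ker ≤ coprimeElements q := Subgroup.comap_mono bot_le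
  have hmap : (coprimeElements q).map f = f.range ⊓ coprimeIdeals q :=
    Subgroup.map_comap_eq f (coprimeIdeals q)
  have h1 : narrowRayClassNumber q =
      (oneModStar q ⊔ f.ker).relIndex (coprimeElements q) * classNumber K := by
    change (principalRay q).relIndex (coprimeIdeals q) = _
    rw [← Subgroup.relIndex_mul_relIndex (principalRay q) (f.range ⊓ coprimeIdeals q) _
      (hmap ▸ Subgroup.map_mono (oneModStar_le_coprimeElements q)) inf_le_right, ← hmap,
      principalRay, Subgroup.relIndex_map_map, sup_eq_left.mpr hker, hmap,
      Subgroup.inf_relIndex_right, ← Subgroup.relIndex_sup_left (coprimeIdeals q) f.range, range_sup_coprimeIdeals hq,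
      Subgroup.relIndex_top_right, index_range_toPrincipalIdeal]
  have h2 : (rayUnits q).index = (oneModStar q).relIndex (oneModStar q ⊔ f.ker) := by
    rw [rayUnits, Subgroup.index_comap, Subgroup.relIndex_sup_left, ker_toPrincipalIdeal]
  rw [h1, h2, ← relIndex_oneModStar_coprimeElements hq, ← Subgroup.relIndex_mul_relIndex _ _ _
    le_sup_left (sup_le (oneModStar_le_coprimeElements q) hker)]
  ring

/-! ### Torsion, regulator and residue -/

/-- By the second isomorphism theorem `[Uμ : U] = [μ : U ∩ μ]`. -/
theorem index_sup_torsion_mul_torsionOrder (q : Ideal (𝓞 K)) :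
    (rayUnits q ⊔ Units.torsion K).index * Units.torsionOrder K =
      (rayUnits q).index * rayTorsionOrder q := by
  have h1 := Subgroup.relIndex_mul_index (le_sup_left : rayUnits q ≤ rayUnits q ⊔ Units.torsion K)
  rw [Subgroup.relIndex_sup_left] at h1
  have h2 := Subgroup.relIndex_mul_relIndex ⊥ (rayUnits q ⊓ Units.torsion K) (Units.torsion K)
    bot_le inf_le_right
  rw [Subgroup.relIndex_bot_left, Subgroup.relIndex_bot_left, Subgroup.inf_relIndex_right] at h2
  have h3 : Units.torsionOrder K =
      rayTorsionOrder q * (rayUnits q).relIndex (Units.torsion K) := by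
    rw [rayTorsionOrder, h2, Units.torsionOrder]
  rw [h3, ← h1]
  ring

theorem rayRegulator_eq_index_mul {q : Ideal (𝓞 K)} (hq : q ≠ ⊥) :
    rayRegulator q = (rayUnits q ⊔ Units.torsion K).index * Units.regulator K := by
  obtain ⟨η, hη⟩ := exists_isRayFundSystem hq
  rw [rayRegulator_eq hη Units.dirichletUnitTheorem.w₀ (Units.equivFinRank K),
    unitDet_eq_regOfFamily, ← hη.sup_eq, ← Units.regOfFamily_div_regulator,
    div_mul_cancel₀ _ (Units.regulator_ne_zero K)]

theorem zetaResidue_eq : zetaResidue K = dedekindZeta_residue K :=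
  tendsto_nhds_unique (tendsto_zetaResidue K) (tendsto_sub_one_mul_dedekindZeta_nhdsGT K)

end RayClass

theorem lemma3p9 {K : Type*} [Field K] [NumberField K] (q : Ideal (𝓞 K)) (hq : q ≠ ⊥) :
    (((2 * π) ^ InfinitePlace.nrComplexPlaces K * RayClass.rayRegulator q /
          ((RayClass.rayTorsionOrder q : ℝ) * √|(discr K : ℝ)|) : ℝ) : ℂ) =
        RayClass.zetaResidue K * (RayClass.idealPhi q : ℂ) /
          (RayClass.narrowRayClassNumber q : ℂ) ∧
      RayClass.rayRegulator q / Units.regulator K =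
        (RayClass.rayTorsionOrder q : ℝ) / (Units.torsionOrder K : ℝ) *
          (2 ^ InfinitePlace.nrRealPlaces K * RayClass.idealPhi q * (classNumber K : ℝ) /
            (RayClass.narrowRayClassNumber q : ℝ)) := by
  have : Finite (𝓞 K ⧸ q) := Ideal.finiteQuotientOfFreeOfNeBot q hq
  have hA := RayClass.narrowRayClassNumber_mul_index_rayUnits hq
  -- An infinite group has `Nat.card` equal to `0`, so nonvanishing of this product also yields
  -- finiteness of the ray class group.
  have hA0 : RayClass.narrowRayClassNumber q * (RayClass.rayUnits q).index ≠ 0 := by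
    rw [hA]
    exact mul_ne_zero (mul_ne_zero (pow_ne_zero _ two_ne_zero) Nat.card_pos.ne')
      (classNumber_pos K).ne'
  have hB := RayClass.index_sup_torsion_mul_torsionOrder q
  have hw : (Units.torsionOrder K : ℝ) ≠ 0 := Nat.cast_ne_zero.mpr (Units.torsionOrder_pos K).ne'
  have hh : (RayClass.narrowRayClassNumber q : ℝ) ≠ 0 :=
    Nat.cast_ne_zero.mpr (left_ne_zero_of_mul hA0)
  have hμ : (RayClass.rayTorsionOrder q : ℝ) ≠ 0 := by
    have : Finite (RayClass.rayUnits q ⊓ Units.torsion K : Subgroup (𝓞 K)ˣ) :=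
      Finite.of_injective _ (Subgroup.inclusion_injective
        (inf_le_right : RayClass.rayUnits q ⊓ Units.torsion K ≤ Units.torsion K))
    exact Nat.cast_ne_zero.mpr Nat.card_pos.ne'
  have hR := Units.regulator_ne_zero K
  have hd : √|(discr K : ℝ)| ≠ 0 := by
    rw [Real.sqrt_ne_zero', abs_pos, Int.cast_ne_zero]
    exact discr_ne_zero K
  have hreg := RayClass.rayRegulator_eq_index_mul hq
  have hA' : (RayClass.narrowRayClassNumber q : ℝ) * (RayClass.rayUnits q).index =
      2 ^ InfinitePlace.nrRealPlaces K * RayClass.idealPhi q * classNumber K := by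
    rw [← RayClass.card_units_quotient hq]; exact_mod_cast hA
  have hB' : ((RayClass.rayUnits q ⊔ Units.torsion K).index : ℝ) * Units.torsionOrder K =
      (RayClass.rayUnits q).index * RayClass.rayTorsionOrder q := mod_cast hB
  have key : RayClass.rayRegulator q / Units.regulator K =
      (RayClass.rayTorsionOrder q : ℝ) / (Units.torsionOrder K : ℝ) *
        (2 ^ InfinitePlace.nrRealPlaces K * RayClass.idealPhi q * (classNumber K : ℝ) /
          (RayClass.narrowRayClassNumber q : ℝ)) := by
    rw [hreg, ← hA', mul_div_cancel_right₀ _ hR, mul_div_cancel_left₀ _ hh]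
    field_simp
    linear_combination hB'
  refine ⟨?_, key⟩
  -- Substituting for the ray regulator cancels its torsion order and leaves the class number
  -- formula for the residue.
  rw [div_eq_iff hR] at key
  rw [RayClass.zetaResidue_eq, ← Complex.ofReal_natCast, ← Complex.ofReal_mul,
    ← Complex.ofReal_div, key, dedekindZeta_residue_def]
  congr 1
  field_simp
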